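/- Let $\Gamma$ be a finite simplicial graph (no loops or multiple edges), and let $A_\Gamma$ be its right-angled Artin group: the group generated by the vertices of $\Gamma$, with the relations that adjacent vertices commute. For a full subgraph $J\subset\Gamma$, write $A_J<A_\Gamma$ for the subgroup generated by the vertices of $J$. If $J$ is the join $\Gamma_1*\dots*\Gamma_m$ of full subgraphs $\Gamma_1,\dots,\Gamma_m$ of $\Gamma$ (that is, their vertex sets are pairwise disjoint with union the vertex set of $J$, and vertices in different $\Gamma_i$ are adjacent), then $A_J$ is the internal direct product $A_{\Gamma_1}\times\dots\times A_{\Gamma_m}$. $\Gamma$ is *homogeneous of dimension $1$* if it is non-empty and has no edges; for $n>1$ it is *homogeneous of dimension $n$* if it is connected and the link of every vertex (the full subgraph spanned by the neighbours of the vertex) is homogeneous of dimension $n-1$. A *$\mathbb{Z}^n$-subgroup* is a subgroup isomorphic to $\mathbb{Z}^n$; it is *maximal* if it is not properly contained in another $\mathbb{Z}^n$-subgroup. A *basic $\mathbb{Z}^n$-subgroup* of $A_\Gamma$ is a maximal $\mathbb{Z}^n$-subgroup that is contained in $A_J$ for some join $J\subset\Gamma$ of $n$ non-empty discrete (edgeless)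 full subgraphs of $\Gamma$. Then: 1. For every abelian subgroup $H<A_\Gamma$ there are an integer $m\ge 0$, non-empty full subgraphs $\Gamma_1,\dots,\Gamma_m$ of $\Gamma$ whose join $J$ is a full subgraph of $\Gamma$, and elements $a_i\in A_{\Gamma_i}$ such that $H$ is conjugate in $A_\Gamma$ to a subgroup of the internal direct product $\langle a_1\rangle\times\dots\times\langle a_m\rangle<A_{\Gamma_1}\times\dots\times A_{\Gamma_m}=A_J$. 2. If $\Gamma$ is homogeneous of dimension $n$ and $H<A_\Gamma$ is a maximal $\mathbb{Z}^n$-subgroup, then there are non-empty discrete full subgraphs $\Gamma_1,\dots,\Gamma_n$ of $\Gamma$ whose join $J$ is a full subgraph of $\Gamma$, and elements $a_i\in A_{\Gamma_i}$, such that $H$ is conjugate in $A_\Gamma$ to the internal direct product $\langle a_1\rangle\times\dots\times\langle a_n\rangle<A_{\Gamma_1}\times\dots\times A_{\Gamma_n}=A_J$; in particular, this conjugate of $H$ is a basic $\mathbb{Z}^n$-subgroup. -/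

import Mathlib

universe u

/-- The right-angled Artin group of a graph: one generator for each vertex, and the relation
that the commutator of two generators is trivial for each pair of adjacent vertices. -/
abbrev RAAG {V : Type u} (Γ : SimpleGraph V) : Type u :=
  PresentedGroup {r : FreeGroup V | ∃ v w : V, Γ.Adj v w ∧
    r = FreeGroup.of v * FreeGroup.of w * (FreeGroup.of v)⁻¹ * (FreeGroup.of w)⁻¹}

namespace RAAG

/-- The generator of the right-angled Artin group given by the vertex `v`. -/
def gen {V : Type u} (Γ : SimpleGraph V) (v : V) : RAAG Γ := PresentedGroup.of v

/-- For a set `S` of vertices, spanning the full subgraph `J` of `Γ`, the subgroup `A_J` of `A_Γ`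
generated by the vertices in `S`. -/
def special {V : Type u} (Γ : SimpleGraph V) (S : Set V) : Subgroup (RAAG Γ) :=
  Subgroup.closure (gen Γ '' S)

/-- The full subgraph of `Γ` spanned by `⋃ i, W i` is the join of the full subgraphs `Γ_i` of `Γ`
spanned by the sets `W i`: these sets are pairwise disjoint, and vertices in different sets are
adjacent. -/
structure IsJoin {V : Type u} (Γ : SimpleGraph V) {m : ℕ} (W : Fin m → Set V) : Prop where
  disjoint : ∀ i j, i ≠ j → Disjoint (W i) (W j)
  adj : ∀ i j, i ≠ j → ∀ v ∈ W i, ∀ w ∈ W j, Γ.Adj v w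

/-- Homogeneous graphs of dimension `n`, for `n ≥ 1` (used for finite graphs). Dimension `1`:
non-empty and without edges. Dimension `n > 1`: connected, and the link of every vertex (the full
subgraph spanned by its neighbours) is homogeneous of dimension `n - 1`. -/
def IsHomogeneous : ℕ → {V : Type u} → SimpleGraph V → Prop
  | 0, _, _ => False
  | 1, V, Γ => Nonempty V ∧ Γ = ⊥
  | n + 2, V, Γ => Γ.Connected ∧ ∀ v : V, IsHomogeneous (n + 1) (Γ.induce (Γ.neighborSet v))

/-- The subgroup `P` of `G` is the internal direct product of the subgroups `K i`. -/
structure IsInternalProduct {G : Type u} [Group G] {m : ℕ} (K : Fin m → Subgroup G)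
    (P : Subgroup G) : Prop where
  commute : ∀ i j, i ≠ j → ∀ x ∈ K i, ∀ y ∈ K j, Commute x y
  indep : iSupIndep K
  iSup_eq : ⨆ i, K i = P

/-- A `ℤⁿ`-subgroup: a subgroup isomorphic to `ℤⁿ`. -/
def IsZnSubgroup {G : Type u} [Group G] (n : ℕ) (H : Subgroup G) : Prop :=
  Nonempty (H ≃* Multiplicative (Fin n → ℤ))

/-- A maximal `ℤⁿ`-subgroup: a `ℤⁿ`-subgroup that is not properly contained in another one. -/
def IsMaximalZnSubgroup {G : Type u} [Group G] (n : ℕ) (H : Subgroup G) : Prop :=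
  Maximal (IsZnSubgroup n) H

/-- A basic `ℤⁿ`-subgroup of `A_Γ`: a maximal `ℤⁿ`-subgroup that is contained in `A_J` for some
join `J ⊆ Γ` of `n` non-empty discrete graphs. -/
def IsBasicZnSubgroup {V : Type u} (Γ : SimpleGraph V) (n : ℕ) (H : Subgroup (RAAG Γ)) : Prop :=
  IsMaximalZnSubgroup n H ∧
    ∃ W : Fin n → Set V, IsJoin Γ W ∧ (∀ i, (W i).Nonempty) ∧ (∀ i, Γ.induce (W i) = ⊥) ∧
      H ≤ special Γ (⋃ i, W i)

/-- The conjugate `g H g⁻¹` of a subgroup. -/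
def conjSubgroup {G : Type u} [Group G] (g : G) (H : Subgroup G) : Subgroup G :=
  H.map (MulAut.conj g).toMonoidHom

end RAAG

/-!
The proof rests on the action of `A_Γ`, for each vertex `v`, on the Bass–Serre tree of the splitting
of `A_Γ` as an HNN extension of `A_{Γ-v}` over `A_{lk v}` with stable letter `v`. This tree is made
explicit: `A_Γ` is the semidirect product of `A_{Γ-v}` with the free group on the cosets
`A_{Γ-v} / A_{lk v}` (`RAAG.splittingEquiv`), and it acts on the Cayley tree of this free group.
Metric arguments on the tree are phrased for Lyndon length functions. If `h` is not conjugate into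
`A_{Γ-v}`, it is hyperbolic, and the Busemann function of its attracting end restricts to a
homomorphism from the centralizer of `h` to `ℤ` whose kernel consists of the elements conjugate into
`A_{Γ-v}`; they are even conjugate into `A_{lk v}` (`RAAG.exists_translation`). The retractions
`A_Γ → A_S` that kill the vertices outside `S` show that an element conjugate into `A_S` and into
`A_T` is conjugate into `A_{S ∩ T}` (`RAAG.ConjInto.inter`).

An abelian subgroup `H` contains an element `h` with the largest essential support `S`, where `v`
belongs to the essential support if `h` is not conjugate into `A_{Γ-v}`. After conjugation `h` lies
in `A_S`. The centralizer of `h` lies in `A_S × A_L` for the common link `L` of `S`, and maximality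
of `S` makes the second component of every element of `H` trivial, so `H ≤ A_S`. Let `W i` be the
vertex sets of the components of the complementary graph on `S`; then `A_S` is the product of the
`A_{W i}`. The projection of `H` to each factor is cyclic: if `v` and `w` are not adjacent, then an
element of translation length zero for `v` is conjugate into `A_{lk v} ≤ A_{Γ-w}`, so it has
translation length zero for `w`. Hence an element with translation length zero for one vertex of
`W i` is conjugate into `A_{Γ-w}` for all `w` in `W i`, and it is trivial. So the translation length
for one vertex embeds the projection in `ℤ` (`RAAG.exists_eq_zpowers_of_connected`).

If `Γ` is homogeneous of dimension `n`, its cliques have at most `n` vertices, so a join has at most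
`n` non-empty factors, and the factors of a join of `n` are discrete. A `ℤⁿ`-subgroup contained in a
product of `m ≤ n` cyclic groups forces `m = n` and all factors to be infinite, so the product is a
`ℤⁿ`-subgroup itself, and a maximal `ℤⁿ`-subgroup is all of it.
-/

/-! ### Lyndon length functions -/

/-- Twice the Gromov product of `x` and `y` with respect to a length function `l`, based at `1`. -/
def gromovProd {G : Type*} [Group G] (l : G → ℕ) (x y : G) : ℤ := l x + l y - l (x⁻¹ * y)

/-- A Lyndon length function, abstracting the displacement of a base vertex under an action on a
tree. The condition `ultra` is `0`-hyperbolicity. -/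
structure IsLyndonLength {G : Type*} [Group G] (l : G → ℕ) : Prop where
  one : l 1 = 0
  inv : ∀ x, l x⁻¹ = l x
  ultra : ∀ x y z, min (gromovProd l x y) (gromovProd l y z) ≤ gromovProd l x z

namespace IsLyndonLength

variable {G : Type*} [Group G] {l : G → ℕ}

theorem gromovProd_comm (hl : IsLyndonLength l) (x y : G) :
    gromovProd l x y = gromovProd l y x := by
  have := hl.inv (x⁻¹ * y)
  simp only [mul_inv_rev, inv_inv] at this
  simp only [gromovProd, this]
  ring

theorem gromovProd_nonneg (hl : IsLyndonLength l) (x y : G) : 0 ≤ gromovProd l x y := by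
  have h := hl.ultra x 1 y
  have h1 : gromovProd l x 1 = 0 := by simp [gromovProd, hl.one, hl.inv]
  have h2 : gromovProd l 1 y = 0 := by simp [gromovProd, hl.one]
  simpa [h1, h2] using h

theorem mul_le (hl : IsLyndonLength l) (x y : G) : l (x * y) ≤ l x + l y := by
  have h := hl.gromovProd_nonneg x⁻¹ y
  simp only [gromovProd, hl.inv, inv_inv] at h
  omega

theorem gromovProd_le (hl : IsLyndonLength l) (x y : G) : gromovProd l x y ≤ 2 * l x := by
  have h := hl.mul_le x (x⁻¹ * y)
  rw [mul_inv_cancel_left] at h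
  simp only [gromovProd]
  omega

/-- If `r` and `s` agree on an initial segment longer than `x`, they look the same from `x`. -/
theorem gromovProd_congr (hl : IsLyndonLength l) {x r s : G}
    (h : 2 * (l x : ℤ) ≤ gromovProd l r s) :
    gromovProd l x r = gromovProd l x s := by
  have h1 := hl.ultra x r s
  have h2 := hl.ultra x s r
  have h3 := hl.gromovProd_le x r
  have h4 := hl.gromovProd_le x s
  rw [hl.gromovProd_comm s r] at h2
  rw [min_eq_left (by omega)] at h1 h2
  exact le_antisymm h1 h2

theorem pow_eq_zero (hl : IsLyndonLength l) {x : G} (hx : l x = 0) (k : ℕ) : l (x ^ k) = 0 := by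
  induction k with
  | zero => simpa using hl.one
  | succ k ih =>
    have := hl.mul_le (x ^ k) x
    rw [pow_succ]
    omega

/-- An element is cyclically reduced when its square has twice its length, in which case its axis
passes through the base vertex. The length is then multiplicative on powers. -/
theorem length_pow (hl : IsLyndonLength l) {h : G} (h2 : l (h * h) = 2 * l h) (n : ℕ) :
    l (h ^ n) = n * l h := by
  rcases Nat.eq_zero_or_pos (l h) with h0 | hpos
  · simpa [h0] using hl.pow_eq_zero h0 n
  suffices H : ∀ n, l (h ^ n) = n * l h ∧ l (h ^ (n + 1)) = (n + 1) * l h from (H n).1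
  intro n
  induction n with
  | zero => simp [hl.one]
  | succ n ih =>
    refine ⟨by exact_mod_cast ih.2, ?_⟩
    have e1 : gromovProd l h (h ^ (n + 1)) = 2 * l h := by
      have : h⁻¹ * h ^ (n + 1) = h ^ n := by rw [pow_succ']; group
      simp only [gromovProd, this, ih.1, ih.2]
      push_cast
      ring
    have e2 : gromovProd l h⁻¹ h = 0 := by
      simp only [gromovProd, inv_inv, h2, hl.inv]
      push_cast
      ring
    have e3 := hl.ultra h⁻¹ (h ^ (n + 1)) h
    rw [e2, hl.gromovProd_comm _ h, e1] at e3
    have e4 := hl.gromovProd_nonneg h⁻¹ (h ^ (n + 1))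
    have e5 : gromovProd l h⁻¹ (h ^ (n + 1)) = 0 := by
      rcases min_le_iff.1 e3 with e | e <;> omega
    simp only [gromovProd, inv_inv, hl.inv, ih.2, ← pow_succ'] at e5
    have : (l (h ^ (n + 1 + 1)) : ℤ) = ((n + 1 + 1) * l h : ℕ) := by
      push_cast at e5 ⊢
      linarith
    exact_mod_cast this

theorem le_gromovProd_pow (hl : IsLyndonLength l) {h : G} (h2 : l (h * h) = 2 * l h)
    (hpos : 0 < l h) {n m : ℕ} (hnm : n ≤ m) : 2 * (n : ℤ) ≤ gromovProd l (h ^ n) (h ^ m) := by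
  obtain ⟨k, rfl⟩ := Nat.exists_eq_add_of_le hnm
  have : (h ^ n)⁻¹ * h ^ (n + k) = h ^ k := by rw [pow_add]; group
  simp only [gromovProd, this, hl.length_pow h2]
  push_cast
  nlinarith

/-- The Busemann function of the end `h ^ ∞`, for `h` cyclically reduced. -/
def busemann (l : G → ℕ) (h x : G) : ℤ := gromovProd l x (h ^ l x) - l x

theorem busemann_eq (hl : IsLyndonLength l) {h : G} (h2 : l (h * h) = 2 * l h)
    (hpos : 0 < l h) {x : G} {n : ℕ} (hn : l x ≤ n) :
    gromovProd l x (h ^ n) - l x = busemann l h x := by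
  rw [busemann, hl.gromovProd_congr (hl.le_gromovProd_pow h2 hpos hn)]

theorem busemann_mul (hl : IsLyndonLength l) {h : G} (h2 : l (h * h) = 2 * l h)
    (hpos : 0 < l h) {x y : G} (hx : Commute x h) :
    busemann l h (x * y) = busemann l h x + busemann l h y := by
  have hn := hl.mul_le x y
  rw [← hl.busemann_eq h2 hpos hn, ← hl.busemann_eq h2 hpos (Nat.le_add_right (l x) (l y)),
    ← hl.busemann_eq h2 hpos (Nat.le_add_left (l y) (l x))]
  set n := l x + l y
  -- since `x` commutes with `h`, the points `x⁻¹ h ^ n` converge to the same end as `h ^ n`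
  have key : gromovProd l y (x⁻¹ * h ^ n) = gromovProd l y (h ^ n) := by
    apply hl.gromovProd_congr
    have e1 : (x⁻¹ * h ^ n)⁻¹ * h ^ n = x := by
      have := (hx.pow_right n).eq
      rw [mul_inv_rev, inv_inv, mul_assoc, this]; group
    have e2 := hl.mul_le x (x⁻¹ * h ^ n)
    rw [mul_inv_cancel_left, hl.length_pow h2] at e2
    have e3 : n ≤ n * l h := Nat.le_mul_of_pos_right _ hpos
    simp only [gromovProd, e1, hl.length_pow h2]
    omega
  simp only [gromovProd] at key ⊢
  rw [mul_inv_rev, mul_assoc]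
  omega

theorem busemann_one (hl : IsLyndonLength l) (h : G) : busemann l h 1 = 0 := by
  simp [busemann, gromovProd, hl.one]

theorem busemann_inv (hl : IsLyndonLength l) {h : G} (h2 : l (h * h) = 2 * l h)
    (hpos : 0 < l h) {x : G} (hx : Commute x h) : busemann l h x⁻¹ = - busemann l h x := by
  have := hl.busemann_mul h2 hpos (y := x⁻¹) hx
  rw [mul_inv_cancel, hl.busemann_one] at this
  omega

theorem busemann_pow (hl : IsLyndonLength l) {h : G} (h2 : l (h * h) = 2 * l h)
    (hpos : 0 < l h) {x : G} (hx : Commute x h) (k : ℕ) :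
    busemann l h (x ^ k) = k * busemann l h x := by
  induction k with
  | zero => simp [hl.busemann_one]
  | succ k ih =>
    rw [pow_succ, hl.busemann_mul h2 hpos (hx.pow_left k), ih]
    push_cast
    ring

/-- An element with bounded orbits does not translate along the axis of `h`. -/
theorem busemann_eq_zero_of_conj (hl : IsLyndonLength l) {h : G} (h2 : l (h * h) = 2 * l h)
    (hpos : 0 < l h) {x g : G} (hx : Commute x h) (hg : l (g * x * g⁻¹) = 0) :
    busemann l h x = 0 := by
  have bound : ∀ k : ℕ, l (x ^ k) ≤ 2 * l g := fun k => by
    have e : x ^ k = g⁻¹ * ((g * x * g⁻¹) ^ k * g) := by rw [conj_pow]; group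
    have e1 := hl.mul_le g⁻¹ ((g * x * g⁻¹) ^ k * g)
    have e2 := hl.mul_le ((g * x * g⁻¹) ^ k) g
    rw [← e, hl.inv] at e1
    rw [hl.pow_eq_zero hg] at e2
    omega
  have habs : |busemann l h (x ^ (2 * l g + 1))| ≤ 2 * l g := by
    have e1 := hl.gromovProd_le (x ^ (2 * l g + 1)) (h ^ l (x ^ (2 * l g + 1)))
    have e2 := hl.gromovProd_nonneg (x ^ (2 * l g + 1)) (h ^ l (x ^ (2 * l g + 1)))
    have e3 := bound (2 * l g + 1)
    rw [busemann, abs_le]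
    constructor <;> omega
  rw [hl.busemann_pow h2 hpos hx, abs_mul] at habs
  by_contra hne
  have : 1 ≤ |busemann l h x| := Int.one_le_abs hne
  push_cast at habs
  rw [abs_of_nonneg (by positivity)] at habs
  nlinarith

/-- An element commuting with `h` that does not translate along the axis of `h` fixes the base
vertex, which lies on this axis. -/
theorem length_eq_zero_of_busemann (hl : IsLyndonLength l) {h : G} (h2 : l (h * h) = 2 * l h)
    (hpos : 0 < l h) {x : G} (hx : Commute x h) (hb : busemann l h x = 0) : l x = 0 := by
  have h2' : l (h⁻¹ * h⁻¹) = 2 * l h⁻¹ := by rw [← mul_inv_rev, hl.inv, hl.inv, h2]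
  have hpos' : 0 < l h⁻¹ := by rwa [hl.inv]
  -- leaving the axis at the base vertex means moving away from the opposite end `h ^ (-∞)`
  have key : ∀ y : G, busemann l h y = 0 → busemann l h⁻¹ y = - l y := fun y hy => by
    have e1 := hl.busemann_eq h2 hpos (le_refl (l y))
    have e2 := hl.busemann_eq h2' hpos' (le_refl (l y))
    have e3 : gromovProd l (h ^ l y) (h⁻¹ ^ l y) = 0 := by
      have : (h ^ l y)⁻¹ * h⁻¹ ^ l y = (h⁻¹) ^ (l y + l y) := by rw [pow_add]; simp
      simp only [gromovProd, this, hl.length_pow h2', hl.length_pow h2, hl.inv]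
      push_cast
      ring
    have e4 := hl.ultra (h ^ l y) y (h⁻¹ ^ l y)
    rw [e3, hl.gromovProd_comm _ y] at e4
    have e5 := hl.gromovProd_nonneg y (h⁻¹ ^ l y)
    have e6 := hl.gromovProd_le y (h⁻¹ ^ l y)
    rcases min_le_iff.1 e4 with e | e <;> omega
  have k1 := key x hb
  have k2 := key x⁻¹ (by rw [hl.busemann_inv h2 hpos hx, hb, neg_zero])
  rw [hl.busemann_inv h2' hpos' hx.inv_right, hl.inv, k1] at k2
  omega

end IsLyndonLength

/-! ### Free groups with permuted bases -/

namespace FreeGroup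

open Classical in
/-- The length of the longest common prefix of two lists. -/
noncomputable def lcp {α : Type*} : List α → List α → ℕ
  | a :: p, b :: q => if a = b then lcp p q + 1 else 0
  | [], _ => 0
  | _ :: _, [] => 0

theorem min_lcp_le {α : Type*} (p q r : List α) : min (lcp p q) (lcp q r) ≤ lcp p r := by
  induction p generalizing q r with
  | nil => cases q <;> cases r <;> simp [lcp]
  | cons a p ih =>
    rcases q with _ | ⟨b, q⟩
    · simp [lcp]
    rcases r with _ | ⟨c, r⟩
    · simp [lcp]
    simp only [lcp]
    have := ih q r
    by_cases h1 : a = b <;> by_cases h2 : b = c <;> simp_all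

variable {X : Type*}

theorem length_reduce_add_lcp [DecidableEq X] (p q : List (X × Bool)) (hp : IsReduced p)
    (hq : IsReduced q) :
    (reduce (invRev p ++ q)).length + 2 * lcp p q = p.length + q.length := by
  induction p generalizing q with
  | nil => cases q <;> simp [lcp, hq.reduce_eq]
  | cons a p ih =>
    rcases q with _ | ⟨b, q⟩
    · have : reduce (a :: p) = a :: p := hp.reduce_eq
      simp [lcp, reduce_invRev, this]
    by_cases hab : a = b
    · subst hab
      have hp' : IsReduced p := hp.infix (List.suffix_cons a p).isInfix
      have hq' : IsReduced q := hq.infix (List.suffix_cons a q).isInfix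
      have e : reduce (invRev (a :: p) ++ a :: q) = reduce (invRev p ++ q) := by
        apply reduce.sound
        rw [← mul_mk, ← mul_mk, ← inv_mk, ← inv_mk,
          show a :: p = [a] ++ p from rfl, show a :: q = [a] ++ q from rfl, ← mul_mk, ← mul_mk]
        group
      have := ih q hp' hq'
      rw [e]
      simp only [lcp, if_true, List.length_cons]
      omega
    · have hred : IsReduced (invRev (a :: p) ++ b :: q) := by
        have h1 : IsReduced (invRev (a :: p)) := by
          rw [isReduced_iff_reduce_eq, reduce_invRev, hp.reduce_eq]
        refine List.IsChain.append h1 hq ?_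
        have hlast : (invRev (a :: p)).getLast? = some (a.1, !a.2) := by simp [invRev]
        intro x hx y hy hxy
        rw [hlast] at hx
        simp only [Option.mem_def, Option.some.injEq, List.head?_cons] at hx hy
        subst hx hy
        rcases a with ⟨a, s⟩
        rcases b with ⟨b, t⟩
        simp only at hxy
        subst hxy
        cases s <;> cases t <;> simp_all
      rw [hred.reduce_eq]
      simp [lcp, hab]

theorem gromovProd_norm [DecidableEq X] (x y : FreeGroup X) :
    gromovProd norm x y = 2 * lcp x.toWord y.toWord := by
  have := length_reduce_add_lcp x.toWord y.toWord isReduced_toWord isReduced_toWord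
  rw [← toWord_inv, ← toWord_mul] at this
  simp only [gromovProd, norm]
  omega

theorem isLyndonLength_norm [DecidableEq X] : IsLyndonLength (norm : FreeGroup X → ℕ) := by
  refine ⟨norm_one, fun x => norm_inv_eq, fun x y z => ?_⟩
  simp only [gromovProd_norm]
  have := min_lcp_le x.toWord y.toWord z.toWord
  omega

theorem toWord_map_of_injective [DecidableEq X] {f : X → X} (hf : Function.Injective f)
    (x : FreeGroup X) : (map f x).toWord = x.toWord.map (fun p => (f p.1, p.2)) := by
  conv_lhs => rw [← mk_toWord (x := x), map.mk, toWord_mk]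
  apply IsReduced.reduce_eq
  have : IsReduced x.toWord := isReduced_toWord
  rw [IsReduced, List.isChain_map]
  exact List.IsChain.imp (fun a b h e => h (hf e)) this

end FreeGroup

/-- The action of a group on the free group on `X` that permutes the basis `X`. -/
def permHom (A X : Type*) [Group A] [MulAction A X] : A →* MulAut (FreeGroup X) where
  toFun a := FreeGroup.freeGroupCongr (MulAction.toPerm a)
  map_one' := by
    refine MulEquiv.ext fun f => ?_
    change FreeGroup.map _ f = f
    rw [show ⇑(MulAction.toPerm (1 : A)) = (id : X → X) from funext (one_smul A), FreeGroup.map.id]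
  map_mul' a b := by
    refine MulEquiv.ext fun f => ?_
    change FreeGroup.map _ f = FreeGroup.map _ (FreeGroup.map _ f)
    rw [FreeGroup.map.comp]
    exact congrArg (fun φ => FreeGroup.map φ f) (funext (mul_smul a b))

/-- The semidirect product `F(X) ⋊ A` in which `A` permutes the basis `X` of the free group. It acts
on the Cayley tree of `F(X)`, and the vertex stabilizers are the conjugates of `A`. -/
abbrev PermProduct (A X : Type*) [Group A] [MulAction A X] : Type _ :=
  FreeGroup X ⋊[permHom A X] A

namespace PermProduct

variable {A X : Type*} [Group A] [MulAction A X]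

theorem permHom_apply (a : A) (f : FreeGroup X) :
    permHom A X a f = FreeGroup.map (fun e => a • e) f := rfl

theorem toWord_permHom [DecidableEq X] (a : A) (f : FreeGroup X) :
    (permHom A X a f).toWord = f.toWord.map (fun p => (a • p.1, p.2)) :=
  FreeGroup.toWord_map_of_injective (MulAction.injective a) f

open Classical in
/-- The displacement of the vertex `1` of the Cayley tree of `F(X)`. -/
noncomputable def length (s : PermProduct A X) : ℕ := s.left.norm

theorem length_eq_zero {s : PermProduct A X} : length s = 0 ↔ s.left = 1 := by
  classical
  simp [length]

theorem norm_permHom [DecidableEq X] (a : A) (f : FreeGroup X) :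
    (permHom A X a f).norm = f.norm := by
  simp [FreeGroup.norm, toWord_permHom]

open Classical in
theorem gromovProd_length (s t : PermProduct A X) :
    gromovProd length s t = gromovProd FreeGroup.norm s.left t.left := by
  have : length (s⁻¹ * t) = FreeGroup.norm (s.left⁻¹ * t.left) := by
    simp only [length, SemidirectProduct.mul_left, SemidirectProduct.inv_left,
      SemidirectProduct.inv_right, ← map_mul]
    exact norm_permHom s.right⁻¹ (s.left⁻¹ * t.left)
  rw [gromovProd, this]
  rfl

theorem isLyndonLength : IsLyndonLength (length : PermProduct A X → ℕ) := by
  classical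
  refine ⟨by simp [length_eq_zero], fun s => ?_, fun x y z => ?_⟩
  · rw [length, SemidirectProduct.inv_left, norm_permHom, FreeGroup.norm_inv_eq, length]
  · simp only [gromovProd_length]
    exact FreeGroup.isLyndonLength_norm.ultra _ _ _

/-- If an element of the vertex stabilizer `A` commutes with an element moving this vertex, then it
fixes an edge at this vertex. -/
theorem exists_smul_eq_of_commute {a : A} {s : PermProduct A X}
    (hs : s.left ≠ 1) (h : Commute (SemidirectProduct.inr a) s) : ∃ e : X, a • e = e := by
  classical
  have h1 : permHom A X a s.left = s.left := by
    have := congrArg SemidirectProduct.left h.eq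
    simpa using this
  have h2 := toWord_permHom a s.left
  rw [h1] at h2
  rcases hw : s.left.toWord with _ | ⟨p, w⟩
  · exact absurd (FreeGroup.toWord_eq_nil_iff.1 hw) hs
  · rw [hw, List.map_cons, List.cons_eq_cons] at h2
    exact ⟨p.1, (congrArg Prod.fst h2.1).symm⟩

/-- An element that is not cyclically reduced can be shortened by conjugation: since `A` preserves
the orientation of the edges, it does not invert an edge. -/
theorem exists_conj_lt (h : PermProduct A X) (hne : length (h * h) ≠ 2 * length h) :
    ∃ t : PermProduct A X, length (t⁻¹ * h * t) < length h := by
  classical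
  have hl := isLyndonLength (A := A) (X := X)
  have e1 : gromovProd length h⁻¹ h ≠ 0 := by
    simp only [gromovProd, inv_inv, hl.inv]
    omega
  rw [gromovProd_length, FreeGroup.gromovProd_norm] at e1
  rcases hw : h.left.toWord with _ | ⟨p, w⟩
  · rw [hw] at e1
    generalize h⁻¹.left.toWord = v at e1
    cases v <;> simp [FreeGroup.lcp] at e1
  rcases hw' : h⁻¹.left.toWord with _ | ⟨q, w'⟩
  · rw [hw'] at e1
    simp [FreeGroup.lcp] at e1
  have hpq : q = p := by
    by_contra hpq
    rw [hw, hw'] at e1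
    simp [FreeGroup.lcp, hpq] at e1
  subst hpq
  -- `t` is the first vertex on the geodesics from `1` to `h` and to `h⁻¹`
  set t : PermProduct A X := SemidirectProduct.inl (FreeGroup.mk [q]) with ht
  have htw : t.left.toWord = [q] := by simp [ht, FreeGroup.toWord_mk]
  have lt : length t = 1 := by simp [length, FreeGroup.norm, htw]
  have e2 : gromovProd length h t = 2 := by
    rw [gromovProd_length, FreeGroup.gromovProd_norm, hw, htw]
    rcases w <;> simp [FreeGroup.lcp]
  have e3 : gromovProd length h⁻¹ t = 2 := by
    rw [gromovProd_length, FreeGroup.gromovProd_norm, hw', htw]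
    rcases w' <;> simp [FreeGroup.lcp]
  have e4 : gromovProd length h (h * t) = 2 * length h - 2 := by
    simp only [gromovProd, inv_inv, hl.inv, inv_mul_cancel_left, lt] at e3 ⊢
    omega
  refine ⟨t, ?_⟩
  have hlen2 : 2 ≤ length h := by
    -- otherwise `h` would invert the edge from `1` to `t`
    by_contra hlt
    have hw0 : w = [] := by
      have : length h = w.length + 1 := by simp [length, FreeGroup.norm, hw]
      exact List.length_eq_zero_iff.1 (by omega)
    subst hw0
    have h5 : h⁻¹.left.toWord = [(h.right⁻¹ • q.1, !q.2)] := by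
      rw [SemidirectProduct.inv_left, toWord_permHom, FreeGroup.toWord_inv, hw]
      simp [FreeGroup.invRev]
    rw [hw', List.cons_eq_cons] at h5
    have := congrArg Prod.snd h5.1
    simp at this
  -- `t` and `h * t` both lie on the geodesic from `1` to `h`, each next to one of its ends
  have e5 := hl.ultra t h (h * t)
  rw [hl.gromovProd_comm t h, e2, e4, min_eq_left (by omega)] at e5
  simp only [gromovProd, lt, inv_inv, hl.inv, mul_assoc] at e3 e5 ⊢
  omega

theorem inv_mul_conj {G : Type*} [Group G] (t g h : G) :
    t⁻¹ * g * h * (t⁻¹ * g)⁻¹ = t⁻¹ * (g * h * g⁻¹) * t := by group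

theorem conj_conj_inv {G : Type*} [Group G] (r g x : G) :
    r * g⁻¹ * (g * x * g⁻¹) * (r * g⁻¹)⁻¹ = r * x * r⁻¹ := by group

/-- The dichotomy between elliptic and hyperbolic elements. The elements commuting with a
hyperbolic element `h` translate along its axis, and those of translation length zero are the
elliptic ones; these fix an edge of the tree. -/
theorem exists_translation (h : PermProduct A X)
    (hh : ∀ g : PermProduct A X, (g * h * g⁻¹).left ≠ 1) :
    ∃ β : PermProduct A X → ℤ,
      (∀ x y, Commute x h → Commute y h → β (x * y) = β x + β y) ∧
      (∀ x, Commute x h → (∃ g, (g * x * g⁻¹).left = 1) → β x = 0) ∧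
      (∀ x, Commute x h → β x = 0 → ∃ (g : PermProduct A X) (a : A) (e : X),
        g * x * g⁻¹ = SemidirectProduct.inr a ∧ a • e = e) := by
  classical
  have hl := isLyndonLength (A := A) (X := X)
  obtain ⟨g, hg⟩ : ∃ g : PermProduct A X, ∀ g', length (g * h * g⁻¹) ≤ length (g' * h * g'⁻¹) := by
    obtain ⟨g, -, hg⟩ := (measure fun g => length (g * h * g⁻¹)).wf.has_min
      (Set.univ : Set (PermProduct A X)) ⟨1, trivial⟩
    exact ⟨g, fun g' => not_lt.1 (hg g' trivial)⟩
  have hpos : 0 < length (g * h * g⁻¹) := Nat.pos_of_ne_zero fun h0 => hh g (length_eq_zero.1 h0)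
  have h2 : length (g * h * g⁻¹ * (g * h * g⁻¹)) = 2 * length (g * h * g⁻¹) := by
    by_contra hne
    obtain ⟨t, ht⟩ := exists_conj_lt (g * h * g⁻¹) hne
    have := hg (t⁻¹ * g)
    rw [inv_mul_conj] at this
    omega
  have hcomm : ∀ {x}, Commute x h → Commute (g * x * g⁻¹) (g * h * g⁻¹) := fun {x} hx =>
    (Commute.conj_iff g).2 hx
  refine ⟨fun x => IsLyndonLength.busemann length (g * h * g⁻¹)
      (g * x * g⁻¹), fun x y hx hy => ?_,
    fun x hx ⟨r, hr⟩ => ?_, fun x hx hx0 => ?_⟩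
  · rw [← hl.busemann_mul h2 hpos (hcomm hx), conj_mul]
  · refine hl.busemann_eq_zero_of_conj h2 hpos (hcomm hx) (g := r * g⁻¹) ?_
    rw [length_eq_zero, conj_conj_inv, hr]
  · have h0 := length_eq_zero.1 (hl.length_eq_zero_of_busemann h2 hpos (hcomm hx) hx0)
    have hinr : g * x * g⁻¹ = SemidirectProduct.inr (g * x * g⁻¹).right :=
      SemidirectProduct.ext h0 rfl
    obtain ⟨e, he⟩ := exists_smul_eq_of_commute (hh g) (hinr ▸ hcomm hx)
    exact ⟨g, _, e, hinr, he⟩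

end PermProduct

/-! ### Special subgroups and retractions -/

namespace RAAG

variable {V : Type u} {Γ : SimpleGraph V}

theorem commute_gen {v w : V} (h : Γ.Adj v w) : Commute (gen Γ v) (gen Γ w) := by
  have h1 : PresentedGroup.mk _ (FreeGroup.of v * FreeGroup.of w * (FreeGroup.of v)⁻¹ *
      (FreeGroup.of w)⁻¹) = (1 : RAAG Γ) := PresentedGroup.one_of_mem ⟨v, w, h, rfl⟩
  simp only [map_mul, map_inv] at h1
  rw [mul_inv_eq_one, mul_inv_eq_iff_eq_mul] at h1
  exact h1

/-- The universal property of the right-angled Artin group. -/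
def lift {G : Type*} [Group G] (f : V → G) (hf : ∀ v w, Γ.Adj v w → Commute (f v) (f w)) :
    RAAG Γ →* G :=
  PresentedGroup.toGroup (f := f) <| by
    rintro _ ⟨v, w, h, rfl⟩
    simp [(hf v w h).eq]

@[simp]
theorem lift_gen {G : Type*} [Group G] (f : V → G)
    (hf : ∀ v w, Γ.Adj v w → Commute (f v) (f w)) (v : V) : lift f hf (gen Γ v) = f v :=
  PresentedGroup.toGroup.of _

theorem hom_ext {G : Type*} [Group G] {φ ψ : RAAG Γ →* G}
    (h : ∀ v, φ (gen Γ v) = ψ (gen Γ v)) : φ = ψ := PresentedGroup.ext h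

theorem gen_mem_special {S : Set V} {v : V} (hv : v ∈ S) : gen Γ v ∈ special Γ S :=
  Subgroup.subset_closure ⟨v, hv, rfl⟩

theorem special_le {S : Set V} {K : Subgroup (RAAG Γ)} :
    special Γ S ≤ K ↔ ∀ v ∈ S, gen Γ v ∈ K := by
  simp [special, Subgroup.closure_le, Set.subset_def]

theorem special_mono {S T : Set V} (h : S ⊆ T) : special Γ S ≤ special Γ T :=
  special_le.2 fun _ hv => gen_mem_special (h hv)

theorem mem_special_univ (x : RAAG Γ) : x ∈ special Γ Set.univ := by
  have : x ∈ (⊤ : Subgroup (RAAG Γ)) := trivial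
  rwa [← PresentedGroup.closure_range_of, ← Set.image_univ] at this

theorem special_empty : special Γ ∅ = ⊥ := by simp [special]

/-- Elements of special subgroups on joined sets of vertices commute. -/
theorem commute_of_join {S T : Set V} (h : ∀ v ∈ S, ∀ w ∈ T, Γ.Adj v w) {x y : RAAG Γ}
    (hx : x ∈ special Γ S) (hy : y ∈ special Γ T) : Commute x y := by
  have h1 : special Γ S ≤ Subgroup.centralizer (special Γ T) := by
    refine special_le.2 fun v hv => ?_
    rw [special, Subgroup.centralizer_closure, Subgroup.mem_centralizer_iff]
    rintro _ ⟨w, hw, rfl⟩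
    exact (commute_gen (h v hv w hw)).symm.eq
  exact (Subgroup.mem_centralizer_iff.1 (h1 hx) y hy).symm

open Classical in
/-- The retraction of `A_Γ` onto the special subgroup `A_S` that kills the vertices outside `S`. -/
noncomputable def retract (Γ : SimpleGraph V) (S : Set V) : RAAG Γ →* RAAG Γ :=
  lift (fun v => if v ∈ S then gen Γ v else 1) fun v w h => by
    split_ifs
    · exact commute_gen h
    · exact Commute.one_right _
    · exact Commute.one_left _
    · exact Commute.one_left _

theorem retract_gen_of_mem {S : Set V} {v : V} (hv : v ∈ S) :
    retract Γ S (gen Γ v) = gen Γ v := by simp [retract, hv]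

theorem retract_gen_of_notMem {S : Set V} {v : V} (hv : v ∉ S) :
    retract Γ S (gen Γ v) = 1 := by simp [retract, hv]

theorem retract_mem_inter {S T : Set V} {x : RAAG Γ} (hx : x ∈ special Γ T) :
    retract Γ S x ∈ special Γ (S ∩ T) := by
  have : special Γ T ≤ (special Γ (S ∩ T)).comap (retract Γ S) := by
    refine special_le.2 fun v hv => ?_
    rw [Subgroup.mem_comap]
    by_cases h : v ∈ S
    · rw [retract_gen_of_mem h]
      exact gen_mem_special ⟨h, hv⟩
    · rw [retract_gen_of_notMem h]
      exact one_mem _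
  exact this hx

theorem retract_mem (S : Set V) (x : RAAG Γ) : retract Γ S x ∈ special Γ S := by
  simpa using retract_mem_inter (S := S) (mem_special_univ x)

theorem retract_of_mem {S : Set V} {x : RAAG Γ} (hx : x ∈ special Γ S) : retract Γ S x = x := by
  have : special Γ S ≤ (retract Γ S).eqLocus (MonoidHom.id _) :=
    special_le.2 fun v hv => retract_gen_of_mem hv
  exact this hx

theorem retract_retract (S T : Set V) (x : RAAG Γ) :
    retract Γ S (retract Γ T x) = retract Γ (S ∩ T) x := by
  have : (retract Γ S).comp (retract Γ T) = retract Γ (S ∩ T) := hom_ext fun v => by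
    by_cases h1 : v ∈ S <;> by_cases h2 : v ∈ T <;>
      simp [retract_gen_of_mem, retract_gen_of_notMem, h1, h2]
  exact DFunLike.congr_fun this x

theorem retract_eq_one {S T : Set V} (h : Disjoint S T) {x : RAAG Γ} (hx : x ∈ special Γ T) :
    retract Γ S x = 1 := by
  have := retract_mem_inter (S := S) hx
  rwa [h.inter_eq, special_empty, Subgroup.mem_bot] at this

theorem mem_special_inter {S T : Set V} {x : RAAG Γ} (hS : x ∈ special Γ S)
    (hT : x ∈ special Γ T) : x ∈ special Γ (S ∩ T) := by
  rw [← retract_of_mem hS]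
  exact retract_mem_inter hT

theorem mem_special_of_forall_notMem [Finite V] {S : Set V} {x : RAAG Γ}
    (h : ∀ v ∉ S, x ∈ special Γ {v}ᶜ) : x ∈ special Γ S := by
  have key : ∀ t : Set V, t.Finite → (∀ v ∈ t, x ∈ special Γ {v}ᶜ) → x ∈ special Γ tᶜ := by
    intro t ht
    induction t, ht using Set.Finite.induction_on with
    | empty => exact fun _ => by simpa using mem_special_univ x
    | @insert v t _ _ ih =>
      intro h
      rw [Set.insert_eq, Set.compl_union]
      exact mem_special_inter (h v (by simp)) (ih fun w hw => h w (by simp [hw]))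
  simpa using key Sᶜ (Set.toFinite _) h

theorem eq_retract_mul_retract {S T : Set V} (hd : Disjoint S T)
    (h : ∀ v ∈ S, ∀ w ∈ T, Γ.Adj v w) {x : RAAG Γ} (hx : x ∈ special Γ (S ∪ T)) :
    x = retract Γ S x * retract Γ T x := by
  induction hx using Subgroup.closure_induction with
  | mem x hx =>
    obtain ⟨v, hv | hv, rfl⟩ := hx
    · rw [retract_gen_of_mem hv, retract_gen_of_notMem (hd.notMem_of_mem_left hv), mul_one]
    · rw [retract_gen_of_mem hv, retract_gen_of_notMem (hd.notMem_of_mem_right hv), one_mul]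
  | one => simp
  | mul x y _ _ ihx ihy =>
    have := (commute_of_join h (retract_mem S y) (retract_mem T x)).eq
    conv_lhs => rw [ihx, ihy]
    rw [map_mul, map_mul, mul_assoc, ← mul_assoc _ _ (retract Γ T y), ← this]
    simp only [mul_assoc]
  | inv x _ ih =>
    have := (commute_of_join h (retract_mem S x) (retract_mem T x)).inv_inv.eq
    conv_lhs => rw [ih]
    rw [map_inv, map_inv, this, mul_inv_rev]

/-! ### Elliptic elements -/

/-- The element `x` is conjugate into the special subgroup `A_S`. -/
def ConjInto (S : Set V) (x : RAAG Γ) : Prop := ∃ g, g * x * g⁻¹ ∈ special Γ S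

theorem ConjInto.mono {S T : Set V} (h : S ⊆ T) {x : RAAG Γ} (hx : ConjInto S x) :
    ConjInto T x := hx.imp fun _ hg => special_mono h hg

theorem conjInto_of_mem {S : Set V} {x : RAAG Γ} (hx : x ∈ special Γ S) : ConjInto S x :=
  ⟨1, by simpa using hx⟩

theorem conjInto_conj {S : Set V} {x : RAAG Γ} (g : RAAG Γ) :
    ConjInto S (g * x * g⁻¹) ↔ ConjInto S x := by
  constructor
  · rintro ⟨k, hk⟩
    exact ⟨k * g, by simpa [mul_assoc] using hk⟩
  · rintro ⟨k, hk⟩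
    exact ⟨k * g⁻¹, by simpa [mul_assoc] using hk⟩

/-- Apply the retraction onto `A_S` to a conjugate of `x` in `A_T`. -/
theorem ConjInto.inter {S T : Set V} {x : RAAG Γ} (hS : ConjInto S x) (hT : ConjInto T x) :
    ConjInto (S ∩ T) x := by
  obtain ⟨g, hg⟩ := hS
  rw [← conjInto_conj g] at hT ⊢
  obtain ⟨k, hk⟩ := hT
  refine ⟨retract Γ S k, ?_⟩
  have := retract_mem_inter (S := S) hk
  rwa [map_mul, map_mul, map_inv, retract_of_mem hg] at this

theorem ConjInto.eq_one {x : RAAG Γ} (h : ConjInto ∅ x) : x = 1 := by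
  obtain ⟨g, hg⟩ := h
  rw [special_empty, Subgroup.mem_bot] at hg
  simpa using hg

theorem ConjInto.retract_eq_one {S T : Set V} (hd : Disjoint S T) {x : RAAG Γ}
    (h : ConjInto T x) : retract Γ S x = 1 := by
  obtain ⟨g, hg⟩ := h
  have := RAAG.retract_eq_one hd hg
  rw [map_mul, map_mul, map_inv] at this
  simpa using this

theorem conjInto_of_forall_notMem [Finite V] {S : Set V} {x : RAAG Γ}
    (h : ∀ v ∉ S, ConjInto {v}ᶜ x) : ConjInto S x := by
  have key : ∀ t : Set V, t.Finite → (∀ v ∈ t, ConjInto {v}ᶜ x) → ConjInto tᶜ x := by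
    intro t ht
    induction t, ht using Set.Finite.induction_on with
    | empty => exact fun _ => conjInto_of_mem (by simpa using mem_special_univ x)
    | @insert v t _ _ ih =>
      intro h
      rw [Set.insert_eq, Set.compl_union]
      exact (h v (by simp)).inter (ih fun w hw => h w (by simp [hw]))
  simpa using key Sᶜ (Set.toFinite _) h

/-! ### Splitting off a vertex -/

section Splitting

variable (Γ) (v : V)

/-- The special subgroup on the vertices different from `v`. -/
abbrev awaySubgroup : Subgroup (RAAG Γ) := special Γ {v}ᶜ

/-- The special subgroup on the link of `v`, inside the one on the complement of `v`. -/
abbrev linkSubgroup : Subgroup (awaySubgroup Γ v) :=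
  (special Γ (Γ.neighborSet v)).subgroupOf (awaySubgroup Γ v)

/-- The semidirect product of `A_{Γ-v}` with the free group on its cosets modulo `A_{lk v}`. -/
abbrev Splitting : Type u :=
  PermProduct (awaySubgroup Γ v) (awaySubgroup Γ v ⧸ linkSubgroup Γ v)

variable {Γ}

theorem commute_gen_of_mem_link {x : RAAG Γ} (hx : x ∈ special Γ (Γ.neighborSet v)) :
    Commute (gen Γ v) x :=
  commute_of_join (S := {v}) (by rintro _ rfl w hw; exact hw) (gen_mem_special rfl) hx

/-- A coset `a A_{lk v}` stands for the conjugate `a v a⁻¹`. -/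
def cosetConj : awaySubgroup Γ v ⧸ linkSubgroup Γ v → RAAG Γ :=
  Quotient.lift (fun a => (a : RAAG Γ) * gen Γ v * (a : RAAG Γ)⁻¹) fun a b hab => by
    have h1 : (a : RAAG Γ)⁻¹ * b ∈ special Γ (Γ.neighborSet v) := by
      have := QuotientGroup.leftRel_apply.1 hab
      simpa [Subgroup.mem_subgroupOf] using this
    have h2 := (commute_gen_of_mem_link v h1).eq
    have h3 : (b : RAAG Γ) = a * ((a : RAAG Γ)⁻¹ * b) := by group
    change (a : RAAG Γ) * gen Γ v * (a : RAAG Γ)⁻¹ = b * gen Γ v * (b : RAAG Γ)⁻¹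
    rw [h3, mul_assoc (a : RAAG Γ) _ (gen Γ v), ← h2]
    group

theorem cosetConj_mk (a : awaySubgroup Γ v) :
    cosetConj v (a : awaySubgroup Γ v ⧸ linkSubgroup Γ v) =
      (a : RAAG Γ) * gen Γ v * (a : RAAG Γ)⁻¹ := rfl

theorem cosetConj_smul (a : awaySubgroup Γ v) (e : awaySubgroup Γ v ⧸ linkSubgroup Γ v) :
    cosetConj v (a • e) = a * cosetConj v e * (a : RAAG Γ)⁻¹ := by
  induction e using QuotientGroup.induction_on with
  | H b =>
    change cosetConj v ((a * b : awaySubgroup Γ v) : awaySubgroup Γ v ⧸ linkSubgroup Γ v) = _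
    rw [cosetConj_mk, cosetConj_mk, Subgroup.coe_mul]
    group

/-- The homomorphism sending `v` to the basis element given by the trivial coset. -/
noncomputable def toSplitting : RAAG Γ →* Splitting Γ v := by
  classical
  exact lift (fun w => if h : w = v then
      SemidirectProduct.inl (FreeGroup.of ((1 : awaySubgroup Γ v) : _ ⧸ linkSubgroup Γ v))
    else SemidirectProduct.inr ⟨gen Γ w, gen_mem_special h⟩) <| by
    have key : ∀ w (h : w ≠ v), Γ.Adj v w → Commute
        (SemidirectProduct.inl (FreeGroup.of ((1 : awaySubgroup Γ v) : _ ⧸ linkSubgroup Γ v)) :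
          Splitting Γ v) (SemidirectProduct.inr ⟨gen Γ w, gen_mem_special h⟩) := by
      intro w h hvw
      -- the generator `w` lies in the link subgroup, so it fixes the trivial coset
      have hfix : (⟨gen Γ w, gen_mem_special h⟩ : awaySubgroup Γ v) •
          ((1 : awaySubgroup Γ v) : awaySubgroup Γ v ⧸ linkSubgroup Γ v) =
          ((1 : awaySubgroup Γ v) : awaySubgroup Γ v ⧸ linkSubgroup Γ v) := by
        change ((⟨gen Γ w, gen_mem_special h⟩ * 1 : awaySubgroup Γ v) : _ ⧸ linkSubgroup Γ v) = _
        rw [mul_one, Eq.comm, QuotientGroup.eq, inv_one, one_mul, Subgroup.mem_subgroupOf]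
        exact gen_mem_special hvw
      refine SemidirectProduct.ext ?_ ?_
      · simp [PermProduct.permHom_apply, hfix]
      · simp
    intro x y hxy
    split_ifs with h1 h2 h2
    · exact Commute.refl _
    · exact key y h2 (h1 ▸ hxy)
    · exact (key x h1 (h2 ▸ hxy.symm)).symm
    · refine Commute.map (f := SemidirectProduct.inr) ?_
      exact Subtype.ext (commute_gen hxy).eq

theorem toSplitting_gen_self : toSplitting v (gen Γ v) =
    SemidirectProduct.inl (FreeGroup.of ((1 : awaySubgroup Γ v) : _ ⧸ linkSubgroup Γ v)) := by
  simp [toSplitting]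

theorem toSplitting_coe (a : awaySubgroup Γ v) :
    toSplitting v (a : RAAG Γ) = SemidirectProduct.inr a := by
  have key : ∀ x ∈ special Γ {v}ᶜ, ∃ a : awaySubgroup Γ v,
      (a : RAAG Γ) = x ∧ toSplitting v x = SemidirectProduct.inr a := by
    intro x hx
    induction hx using Subgroup.closure_induction with
    | mem x hx =>
      obtain ⟨w, hw, rfl⟩ := hx
      have : w ≠ v := hw
      exact ⟨⟨gen Γ w, gen_mem_special hw⟩, rfl, by simp [toSplitting, this]⟩
    | one => exact ⟨1, rfl, by rw [map_one, map_one]⟩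
    | mul x y _ _ ihx ihy =>
      obtain ⟨a, rfl, ha⟩ := ihx
      obtain ⟨b, rfl, hb⟩ := ihy
      exact ⟨a * b, rfl, by rw [map_mul, map_mul, ha, hb]⟩
    | inv x _ ih =>
      obtain ⟨a, rfl, ha⟩ := ih
      exact ⟨a⁻¹, rfl, by rw [map_inv, map_inv, ha]⟩
  obtain ⟨b, hb, h⟩ := key a a.2
  rw [h, Subtype.ext hb]

/-- The inverse of `toSplitting`. -/
def ofSplitting : Splitting Γ v →* RAAG Γ :=
  SemidirectProduct.lift (FreeGroup.lift (cosetConj v)) (awaySubgroup Γ v).subtype fun a => by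
    ext e
    simp [PermProduct.permHom_apply, cosetConj_smul]

theorem ofSplitting_toSplitting (x : RAAG Γ) : ofSplitting v (toSplitting v x) = x := by
  have : (ofSplitting v).comp (toSplitting v) = MonoidHom.id (RAAG Γ) := hom_ext fun w => by
    by_cases h : w = v
    · subst h
      simp [toSplitting_gen_self, ofSplitting, cosetConj_mk]
    · have := toSplitting_coe v ⟨gen Γ w, gen_mem_special h⟩
      simp only at this
      simp [this, ofSplitting]
  exact DFunLike.congr_fun this x

theorem toSplitting_ofSplitting (s : Splitting Γ v) : toSplitting v (ofSplitting v s) = s := by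
  have : (toSplitting v).comp (ofSplitting v) = MonoidHom.id (Splitting Γ v) := by
    refine SemidirectProduct.hom_ext (FreeGroup.ext_hom _ _ fun e => ?_) (MonoidHom.ext fun a => ?_)
    · induction e using QuotientGroup.induction_on with
      | H a =>
        have h1 : a • ((1 : awaySubgroup Γ v) : _ ⧸ linkSubgroup Γ v) = (a : _ ⧸ _) :=
          congrArg _ (mul_one a)
        have h2 := SemidirectProduct.inl_aut (φ := permHom (awaySubgroup Γ v)
          (awaySubgroup Γ v ⧸ linkSubgroup Γ v)) a (FreeGroup.of ((1 : awaySubgroup Γ v) : _ ⧸ _))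
        rw [PermProduct.permHom_apply, FreeGroup.map.of, h1] at h2
        simp [ofSplitting, cosetConj_mk, toSplitting_coe, toSplitting_gen_self, h2]
    · simp [ofSplitting, toSplitting_coe]
  exact DFunLike.congr_fun this s

/-- The group `A_Γ` is the semidirect product of `A_{Γ-v}` with a free group on the cosets of
`A_{lk v}` in it. -/
noncomputable def splittingEquiv : RAAG Γ ≃* Splitting Γ v where
  __ := toSplitting v
  invFun := ofSplitting v
  left_inv := ofSplitting_toSplitting v
  right_inv := toSplitting_ofSplitting v

theorem splittingEquiv_coe (a : awaySubgroup Γ v) :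
    splittingEquiv v (a : RAAG Γ) = SemidirectProduct.inr a := toSplitting_coe v a

theorem splittingEquiv_left_eq_one {x : RAAG Γ} :
    (splittingEquiv v x).left = 1 ↔ x ∈ special Γ {v}ᶜ := by
  constructor
  · intro h
    have h1 : splittingEquiv v x = splittingEquiv v ((splittingEquiv v x).right : RAAG Γ) := by
      rw [splittingEquiv_coe]
      exact SemidirectProduct.ext h rfl
    rw [(splittingEquiv v).injective h1]
    exact ((splittingEquiv v x).right).2
  · intro h
    rw [splittingEquiv_coe v ⟨x, h⟩, SemidirectProduct.left_inr]

theorem conjInto_link {x : RAAG Γ} {a : awaySubgroup Γ v}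
    {e : awaySubgroup Γ v ⧸ linkSubgroup Γ v} (hx : splittingEquiv v x = SemidirectProduct.inr a)
    (he : a • e = e) : ConjInto (Γ.neighborSet v) x := by
  rw [← splittingEquiv_coe, EmbeddingLike.apply_eq_iff_eq] at hx
  subst hx
  induction e using QuotientGroup.induction_on with
  | H b =>
    change ((a * b : awaySubgroup Γ v) : awaySubgroup Γ v ⧸ linkSubgroup Γ v) = b at he
    rw [Eq.comm, QuotientGroup.eq, Subgroup.mem_subgroupOf] at he
    refine ⟨(b : RAAG Γ)⁻¹, ?_⟩
    simpa [mul_assoc] using he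

/-- An element of `A_{Γ-v}` with a centralizer not contained in `A_{Γ-v}` is conjugate into the link
subgroup. -/
theorem conjInto_link_of_commute {x h : RAAG Γ} (hh : h ∈ special Γ {v}ᶜ)
    (hx : x ∉ special Γ {v}ᶜ) (hc : Commute h x) : ConjInto (Γ.neighborSet v) h := by
  have h1 := splittingEquiv_coe v ⟨h, hh⟩
  obtain ⟨e, he⟩ := PermProduct.exists_smul_eq_of_commute
    (mt (splittingEquiv_left_eq_one v).1 hx) (h1 ▸ hc.map (splittingEquiv v))
  exact conjInto_link v h1 he

/-- For `h` not conjugate into `A_{Γ-v}`, the translation length along the axis of `h`. -/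
theorem exists_translation {h : RAAG Γ} (hh : ¬ ConjInto {v}ᶜ h) :
    ∃ β : RAAG Γ → ℤ,
      (∀ x y, Commute x h → Commute y h → β (x * y) = β x + β y) ∧
      (∀ x, Commute x h → (β x = 0 ↔ ConjInto {v}ᶜ x)) ∧
      (∀ x, Commute x h → β x = 0 → ConjInto (Γ.neighborSet v) x) := by
  set E := splittingEquiv (Γ := Γ) v with hE
  obtain ⟨β, h1, h2, h3⟩ := PermProduct.exists_translation (E h) fun g hg => hh <| by
    refine ⟨E.symm g, (splittingEquiv_left_eq_one v).1 ?_⟩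
    rw [← hE, map_mul, map_mul, map_inv, E.apply_symm_apply]
    exact hg
  have h4 : ∀ x, Commute x h → β (E x) = 0 → ConjInto (Γ.neighborSet v) x := by
    intro x hx hb
    obtain ⟨g, a, e, hg, he⟩ := h3 (E x) (hx.map E) hb
    rw [← conjInto_conj (E.symm g)]
    refine conjInto_link v (a := a) (e := e) ?_ he
    rw [← hE, map_mul, map_mul, map_inv, E.apply_symm_apply, hg]
  refine ⟨fun x => β (E x), fun x y hx hy => ?_, fun x hx => ⟨fun hb => ?_, ?_⟩, h4⟩
  · change β (E (x * y)) = _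
    rw [map_mul]
    exact h1 _ _ (hx.map E) (hy.map E)
  · exact (h4 x hx hb).mono fun w hw => by
      rintro rfl
      exact Γ.irrefl hw
  · rintro ⟨g, hg⟩
    refine h2 _ (hx.map E) ⟨E g, ?_⟩
    rw [← map_mul, ← map_inv, ← map_mul]
    exact (splittingEquiv_left_eq_one v).2 hg

end Splitting

end RAAG

/-! ### Internal products of special subgroups -/

namespace RAAG

variable {V : Type u} {Γ : SimpleGraph V}

theorem IsJoin.adj_iUnion {m : ℕ} {W : Fin m → Set V} (hW : IsJoin Γ W) (i : Fin m)
    {p : Fin m → Prop} (hp : ¬ p i) : Disjoint (W i) (⋃ j, ⋃ _ : p j, W j) ∧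
      ∀ v ∈ W i, ∀ w ∈ ⋃ j, ⋃ _ : p j, W j, Γ.Adj v w := by
  constructor
  · simp only [Set.disjoint_iUnion_right]
    exact fun j hj => hW.disjoint i j fun h => hp (h ▸ hj)
  · intro v hv w hw
    simp only [Set.mem_iUnion, exists_prop] at hw
    obtain ⟨j, hj, hw⟩ := hw
    exact hW.adj i j (fun h => hp (h ▸ hj)) v hv w hw

theorem IsJoin.isInternalProduct {m : ℕ} {W : Fin m → Set V} (hW : IsJoin Γ W) :
    IsInternalProduct (fun i => special Γ (W i)) (special Γ (⋃ i, W i)) where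
  commute i j hij x hx y hy := commute_of_join (hW.adj i j hij) hx hy
  indep i := by
    rw [Subgroup.disjoint_def]
    intro x hx hx'
    have hle : ⨆ j, ⨆ _ : j ≠ i, special Γ (W j) ≤ special Γ (⋃ j, ⋃ _ : j ≠ i, W j) :=
      iSup₂_le fun j hj => special_mono (Set.subset_iUnion₂_of_subset j hj subset_rfl)
    rw [← retract_of_mem hx]
    exact retract_eq_one (hW.adj_iUnion i (p := fun j => j ≠ i) (by simp)).1 (hle hx')
  iSup_eq := by
    simp only [special, Set.image_iUnion, Subgroup.closure_iUnion]

theorem IsJoin.isInternalProduct_zpowers {m : ℕ} {W : Fin m → Set V} (hW : IsJoin Γ W)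
    {a : Fin m → RAAG Γ} (ha : ∀ i, a i ∈ special Γ (W i)) :
    IsInternalProduct (fun i => Subgroup.zpowers (a i)) (⨆ i, Subgroup.zpowers (a i)) where
  commute i j hij x hx y hy := hW.isInternalProduct.commute i j hij
    x (Subgroup.zpowers_le.2 (ha i) hx) y (Subgroup.zpowers_le.2 (ha j) hy)
  indep := hW.isInternalProduct.indep.mono fun i => Subgroup.zpowers_le.2 (ha i)
  iSup_eq := rfl

/-- An element of `A_J` is the product of its components in the factors of the join `J`. -/
theorem IsJoin.mem_iSup_zpowers_retract {m : ℕ} {W : Fin m → Set V} (hW : IsJoin Γ W)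
    {x : RAAG Γ} (hx : x ∈ special Γ (⋃ i, W i)) :
    x ∈ ⨆ i, Subgroup.zpowers (retract Γ (W i) x) := by
  suffices key : ∀ s : Finset (Fin m), ∀ x ∈ special Γ (⋃ i, ⋃ _ : i ∈ s, W i),
      x ∈ ⨆ i, Subgroup.zpowers (retract Γ (W i) x) from key Finset.univ x (by simpa using hx)
  intro s
  induction s using Finset.induction_on with
  | empty =>
    intro x hx
    rw [show x = 1 by simpa [special_empty] using hx]
    exact one_mem _
  | @insert i s his ih =>
    intro x hx
    rw [Finset.set_biUnion_insert] at hx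
    obtain ⟨hd, hadj⟩ := hW.adj_iUnion i (p := fun j => j ∈ s) his
    set U := ⋃ j, ⋃ _ : j ∈ s, W j with hU
    have h1 : retract Γ U x ∈ ⨆ i, Subgroup.zpowers (retract Γ (W i) x) := by
      refine (iSup_le fun j => ?_ :
        ⨆ j, Subgroup.zpowers (retract Γ (W j) (retract Γ U x)) ≤ _) (ih _ (retract_mem U x))
      rw [Subgroup.zpowers_le]
      by_cases hj : j ∈ s
      · have hsub : W j ⊆ U := Set.subset_iUnion₂_of_subset j hj subset_rfl
        rw [retract_retract, Set.inter_eq_left.2 hsub]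
        exact Subgroup.mem_iSup_of_mem j (Subgroup.mem_zpowers _)
      · rw [retract_eq_one (hW.adj_iUnion j (p := fun j => j ∈ s) hj).1 (retract_mem U x)]
        exact one_mem _
    have h2 := eq_retract_mul_retract hd hadj hx
    have h3 : retract Γ (W i) x * retract Γ U x ∈ ⨆ i, Subgroup.zpowers (retract Γ (W i) x) :=
      mul_mem (Subgroup.mem_iSup_of_mem i (Subgroup.mem_zpowers _)) h1
    rwa [← h2] at h3

/-! ### Supports of elements -/

/-- The essential support of `x`: the vertices `v` such that `x` is not conjugate into `A_{Γ-v}`,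
that is, the vertices occurring in a cyclically reduced word conjugate to `x`. -/
def essSupport (x : RAAG Γ) : Set V := {v | ¬ ConjInto {v}ᶜ x}

theorem essSupport_conj (g x : RAAG Γ) : essSupport (g * x * g⁻¹) = essSupport x :=
  Set.ext fun _ => not_congr (conjInto_conj g)

theorem conjInto_iff_essSupport_subset [Finite V] {S : Set V} {x : RAAG Γ} :
    ConjInto S x ↔ essSupport x ⊆ S := by
  constructor
  · intro h v hv
    by_contra hvS
    exact hv (h.mono fun w hw => by rintro rfl; exact hvS hw)
  · exact fun h => conjInto_of_forall_notMem fun v hv => not_not.1 fun hv' => hv (h hv')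

theorem subsingleton_notMem_essSupport_pow_mul {x y : RAAG Γ} (hxy : Commute x y) {v : V}
    (hv : v ∈ essSupport x ∪ essSupport y) :
    {k : ℕ | v ∉ essSupport (x ^ k * y)}.Subsingleton := by
  obtain ⟨z, hz, hxz, hyz⟩ : ∃ z, v ∈ essSupport z ∧ Commute x z ∧ Commute y z := by
    rcases hv with hv | hv
    · exact ⟨x, hv, Commute.refl x, hxy.symm⟩
    · exact ⟨y, hv, hxy, Commute.refl y⟩
  obtain ⟨β, hmul, hzero, -⟩ := exists_translation v hz
  have hpow : ∀ k : ℕ, β (x ^ k) = k * β x := fun k => by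
    induction k with
    | zero => simpa using (hzero 1 (Commute.one_left z)).2 (conjInto_of_mem (one_mem _))
    | succ k ih =>
      rw [pow_succ, hmul _ _ (hxz.pow_left k) hxz, ih]
      push_cast
      ring
  have hlin : ∀ k : ℕ, v ∉ essSupport (x ^ k * y) → (k : ℤ) * β x + β y = 0 := fun k hk => by
    rw [← hpow, ← hmul _ _ (hxz.pow_left k) hyz]
    exact (hzero _ ((hxz.pow_left k).mul_left hyz)).2 (not_not.1 hk)
  intro k hk l hl
  have h1 := hlin k hk
  have h2 := hlin l hl
  have h3 : β x ≠ 0 := by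
    intro h0
    rw [h0, mul_zero, zero_add] at h1
    rcases hv with hv | hv
    · exact hv ((hzero x hxz).1 h0)
    · exact hv ((hzero y hyz).1 h1)
  have h4 : (k : ℤ) * β x = l * β x := by linarith
  exact_mod_cast mul_right_cancel₀ h3 h4

theorem exists_essSupport_union_subset [Finite V] {x y : RAAG Γ} (hxy : Commute x y) :
    ∃ k : ℕ, essSupport x ∪ essSupport y ⊆ essSupport (x ^ k * y) := by
  have hfin : (⋃ v ∈ essSupport x ∪ essSupport y,
      {k : ℕ | v ∉ essSupport (x ^ k * y)}).Finite :=
    (Set.toFinite _).biUnion fun v hv => (subsingleton_notMem_essSupport_pow_mul hxy hv).finite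
  obtain ⟨k, hk⟩ := hfin.exists_notMem
  refine ⟨k, fun v hv => ?_⟩
  by_contra h
  exact hk (Set.mem_biUnion hv h)

/-- An abelian subgroup contains an element whose essential support contains all others: for
commuting `x` and `y` and almost all `k`, no translation length cancels in `x ^ k * y`. -/
theorem exists_maximal_essSupport [Finite V] {H : Subgroup (RAAG Γ)}
    (hH : ∀ x ∈ H, ∀ y ∈ H, x * y = y * x) :
    ∃ h ∈ H, ∀ x ∈ H, essSupport x ⊆ essSupport h := by
  obtain ⟨h, hh, hmax⟩ : ∃ h ∈ H, ∀ x ∈ H, essSupport h ⊆ essSupport x →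
      essSupport x ⊆ essSupport h := by
    obtain ⟨S, ⟨h, hh, rfl⟩, hS⟩ := (Set.toFinite (essSupport '' (H : Set (RAAG Γ)))).exists_maximal
      ⟨_, 1, one_mem H, rfl⟩
    exact ⟨h, hh, fun x hx hle => hS ⟨x, hx, rfl⟩ hle⟩
  refine ⟨h, hh, fun x hx => ?_⟩
  obtain ⟨k, hk⟩ := exists_essSupport_union_subset (hH h hh x hx)
  exact (Set.subset_union_right.trans hk).trans
    (hmax _ (mul_mem (pow_mem hh k) hx) (Set.subset_union_left.trans hk))

/-- The centralizer of an element of `A_S` of full support consists of elements of `A_S × A_L`,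
where `L` is the common link of the vertices in `S`. -/
theorem mem_special_union_link_of_commute [Finite V] {S : Set V} {h x : RAAG Γ}
    (hS : h ∈ special Γ S) (hfull : S ⊆ essSupport h) (hc : Commute h x) :
    x ∈ special Γ (S ∪ {v | ∀ s ∈ S, Γ.Adj s v}) := by
  refine mem_special_of_forall_notMem fun v hv => ?_
  simp only [Set.mem_union, Set.mem_ofPred_eq, not_or] at hv
  by_contra hx
  have hSv : S ⊆ {v}ᶜ := fun s hs => by
    rintro rfl
    exact hv.1 hs
  have hlink := conjInto_iff_essSupport_subset.1
    (conjInto_link_of_commute v (special_mono hSv hS) hx hc)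
  exact hv.2 fun s hs => (hlink (hfull hs)).symm

theorem mem_special_of_commute [Finite V] {S : Set V} {h x : RAAG Γ} (hS : h ∈ special Γ S)
    (hfull : S ⊆ essSupport h) (hc : Commute h x) (hx : essSupport x ⊆ S) : x ∈ special Γ S := by
  have hd : Disjoint S {v | ∀ s ∈ S, Γ.Adj s v} :=
    Set.disjoint_left.2 fun v hv hv' => Γ.irrefl (hv' v hv)
  have h1 := eq_retract_mul_retract hd (fun s hs v hv => hv s hs)
    (mem_special_union_link_of_commute hS hfull hc)
  rw [(conjInto_iff_essSupport_subset.2 hx).retract_eq_one hd.symm, mul_one] at h1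
  exact h1 ▸ retract_mem S x

/-- Projecting to a factor of a join preserves the essential support in this factor. -/
theorem mem_essSupport_retract {S T : Set V} (hd : Disjoint S T)
    (hadj : ∀ v ∈ S, ∀ w ∈ T, Γ.Adj v w) {h : RAAG Γ} (hh : h ∈ special Γ (S ∪ T)) {v : V}
    (hvS : v ∈ S) (hv : v ∈ essSupport h) : v ∈ essSupport (retract Γ S h) := by
  rintro ⟨g, hg⟩
  refine hv ⟨retract Γ S g, ?_⟩
  have h1 := retract_mem_inter (S := S) hg
  rw [map_mul, map_mul, map_inv, retract_of_mem (retract_mem S h)] at h1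
  have h2 := (commute_of_join hadj (retract_mem S g) (retract_mem T h)).inv_left.eq
  have h3 : retract Γ S g * h * (retract Γ S g)⁻¹ =
      retract Γ S g * retract Γ S h * (retract Γ S g)⁻¹ * retract Γ T h := by
    conv_lhs => rw [eq_retract_mul_retract hd hadj hh]
    rw [mul_assoc _ _ (retract Γ T h), h2]
    simp only [mul_assoc]
  rw [h3]
  refine mul_mem (special_mono Set.inter_subset_right h1) (special_mono ?_ (retract_mem T h))
  rintro w hw rfl
  exact hd.notMem_of_mem_left hvS hw

/-! ### Abelian subgroups -/

/-- If `S` spans a connected subgraph of the complementary graph, an abelian subgroup of `A_S`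
containing an element of full support is cyclic: along non-adjacent vertices, the elements of
translation length zero are the same, so the translation length for one vertex is injective. -/
theorem exists_eq_zpowers_of_connected [Finite V] {S : Set V} {H : Subgroup (RAAG Γ)}
    (hH : ∀ x ∈ H, ∀ y ∈ H, x * y = y * x) (hHS : H ≤ special Γ S) {h : RAAG Γ} (hh : h ∈ H)
    (hfull : S ⊆ essSupport h) {v : V} (hv : v ∈ S)
    (hconn : ∀ w ∈ S, Relation.ReflTransGen (fun a b => a ∈ S ∧ b ∈ S ∧ ¬ Γ.Adj a b) v w) :
    ∃ a, H = Subgroup.zpowers a := by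
  obtain ⟨β, hmul, hzero, -⟩ := exists_translation v (hfull hv)
  have hcomm : ∀ x : H, Commute (x : RAAG Γ) h := fun x => hH x x.2 h hh
  let φ : H →* Multiplicative ℤ := MonoidHom.mk'
    (fun x => Multiplicative.ofAdd (β x)) fun x y => by
      rw [← ofAdd_add, ← hmul _ _ (hcomm x) (hcomm y), Subgroup.coe_mul]
  have hφ : Function.Injective φ := by
    rw [injective_iff_map_eq_one]
    intro x hx
    have h0 : ConjInto {v}ᶜ (x : RAAG Γ) := (hzero x (hcomm x)).1 (ofAdd_eq_one.1 hx)
    have hall : ∀ w ∈ S, ConjInto {w}ᶜ (x : RAAG Γ) := by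
      intro w hw
      induction hconn w hw with
      | refl => exact h0
      | @tail a b _ hab ih =>
        obtain ⟨ha, hb, hadj⟩ := hab
        obtain ⟨γ, -, hzero', hlink⟩ := exists_translation a (hfull ha)
        refine (hlink x (hcomm x) ((hzero' x (hcomm x)).2 (ih ha))).mono ?_
        rintro c hc rfl
        exact hadj hc
    have h1 : ConjInto Sᶜ (x : RAAG Γ) :=
      conjInto_of_forall_notMem fun w hw => hall w (not_not.1 hw)
    have h2 := (conjInto_of_mem (hHS x.2)).inter h1
    rw [Set.inter_compl_self] at h2
    exact Subtype.ext h2.eq_one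
  have : IsCyclic H := isCyclic_of_injective φ hφ
  obtain ⟨a, ha⟩ := IsCyclic.exists_generator (α := H)
  refine ⟨a, le_antisymm (fun x hx => ?_) (Subgroup.zpowers_le.2 a.2)⟩
  obtain ⟨k, hk⟩ := Subgroup.mem_zpowers_iff.1 (ha ⟨x, hx⟩)
  exact Subgroup.mem_zpowers_iff.2 ⟨k, by simpa using congrArg Subtype.val hk⟩

/-- The vertex sets of the connected components of the complement of a finite graph on `S` form a
join decomposition of the full subgraph on `S`. -/
theorem exists_join_decomposition [Finite V] (Γ : SimpleGraph V) (S : Set V) :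
    ∃ (m : ℕ) (W : Fin m → Set V), IsJoin Γ W ∧ (∀ i, (W i).Nonempty) ∧ ⋃ i, W i = S ∧
      ∀ i, ∀ v ∈ W i, ∀ w ∈ W i,
        Relation.ReflTransGen (fun a b => a ∈ W i ∧ b ∈ W i ∧ ¬ Γ.Adj a b) v w := by
  let D := Γᶜ.induce S
  have : Finite D.ConnectedComponent := Quot.finite _
  let e := Finite.equivFin D.ConnectedComponent
  let W : Fin (Nat.card D.ConnectedComponent) → Set V := fun i =>
    {v | ∃ hv : v ∈ S, D.connectedComponentMk ⟨v, hv⟩ = e.symm i}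
  have hdisj : ∀ i j v, v ∈ W i → v ∈ W j → i = j := by
    rintro i j v ⟨hv, h1⟩ ⟨_, h2⟩
    exact e.symm.injective (h1.symm.trans h2)
  refine ⟨_, W, ⟨fun i j hij => ?_, fun i j hij v hv w hw => ?_⟩, fun i => ?_, ?_, ?_⟩
  · exact Set.disjoint_left.2 fun v hv hw => hij (hdisj i j v hv hw)
  · by_contra hadj
    have hne : v ≠ w := by
      rintro rfl
      exact hij (hdisj i j v hv hw)
    obtain ⟨hvS, h1⟩ := hv
    obtain ⟨hwS, h2⟩ := hw
    have : D.Adj ⟨v, hvS⟩ ⟨w, hwS⟩ := by simp [D, hne, hadj]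
    rw [SimpleGraph.ConnectedComponent.connectedComponentMk_eq_of_adj this, h2] at h1
    exact hij (e.symm.injective h1).symm
  · obtain ⟨⟨v, hv⟩, h⟩ := (e.symm i).exists_rep
    exact ⟨v, hv, h⟩
  · ext v
    simp only [Set.mem_iUnion]
    exact ⟨fun ⟨i, hv, _⟩ => hv, fun hv => ⟨e (D.connectedComponentMk ⟨v, hv⟩), hv, by simp⟩⟩
  · rintro i v ⟨hv, h1⟩ w ⟨hw, h2⟩
    have hreach : D.Reachable ⟨v, hv⟩ ⟨w, hw⟩ :=
      SimpleGraph.ConnectedComponent.exact (h1.trans h2.symm)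
    rw [SimpleGraph.reachable_iff_reflTransGen] at hreach
    suffices key : ∀ z : S, Relation.ReflTransGen D.Adj ⟨v, hv⟩ z → (z : V) ∈ W i ∧
        Relation.ReflTransGen (fun a b => a ∈ W i ∧ b ∈ W i ∧ ¬ Γ.Adj a b) v z from
      (key ⟨w, hw⟩ hreach).2
    intro z hz
    induction hz with
    | refl => exact ⟨⟨hv, h1⟩, Relation.ReflTransGen.refl⟩
    | @tail a b _ hab ih =>
      obtain ⟨⟨ha, ha'⟩, ih⟩ := ih
      have hb : (b : V) ∈ W i :=
        ⟨b.2, by rw [← ha', ← SimpleGraph.ConnectedComponent.connectedComponentMk_eq_of_adj hab]⟩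
      refine ⟨hb, ih.tail ⟨⟨ha, ha'⟩, hb, ?_⟩⟩
      have : Γᶜ.Adj (a : V) b := hab
      exact this.2

theorem mem_conjSubgroup {G : Type u} [Group G] {g x : G} {H : Subgroup G} :
    x ∈ conjSubgroup g H ↔ ∃ y ∈ H, g * y * g⁻¹ = x := by
  simp [conjSubgroup]

/-- An abelian subgroup is conjugate into a product of cyclic subgroups of the factors of a join. -/
theorem exists_conjSubgroup_le_iSup_zpowers [Finite V] {H : Subgroup (RAAG Γ)}
    (hH : ∀ x ∈ H, ∀ y ∈ H, x * y = y * x) :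
    ∃ (m : ℕ) (W : Fin m → Set V) (a : Fin m → RAAG Γ) (g : RAAG Γ),
      IsJoin Γ W ∧ (∀ i, (W i).Nonempty) ∧ (∀ i, a i ∈ special Γ (W i)) ∧
      conjSubgroup g H ≤ ⨆ i, Subgroup.zpowers (a i) := by
  obtain ⟨h, hh, hmax⟩ := exists_maximal_essSupport hH
  obtain ⟨g, hg⟩ := conjInto_iff_essSupport_subset.2 (subset_refl (essSupport h))
  obtain ⟨m, W, hW, hne, hunion, hconn⟩ := exists_join_decomposition Γ (essSupport h)
  have hsub : conjSubgroup g H ≤ special Γ (essSupport h) := by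
    intro x hx
    obtain ⟨y, hy, rfl⟩ := mem_conjSubgroup.1 hx
    refine mem_special_of_commute hg (essSupport_conj g h).ge ?_ ?_
    · exact (Commute.conj_iff g).2 (hH h hh y hy)
    · rw [essSupport_conj]
      exact hmax y hy
  have hcyc : ∀ i, ∃ a, (conjSubgroup g H).map (retract Γ (W i)) = Subgroup.zpowers a := by
    intro i
    obtain ⟨v, hv⟩ := hne i
    refine exists_eq_zpowers_of_connected (S := W i) ?_ ?_
      (Subgroup.mem_map_of_mem _ (mem_conjSubgroup.2 ⟨h, hh, rfl⟩)) ?_ hv (hconn i v hv)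
    · rintro _ ⟨_, hx, rfl⟩ _ ⟨_, hy, rfl⟩
      obtain ⟨x, hxH, rfl⟩ := mem_conjSubgroup.1 hx
      obtain ⟨y, hyH, rfl⟩ := mem_conjSubgroup.1 hy
      exact (((Commute.conj_iff g).2 (hH x hxH y hyH)).map (retract Γ (W i))).eq
    · rintro _ ⟨x, -, rfl⟩
      exact retract_mem _ x
    · intro w hw
      obtain ⟨hd, hadj⟩ := hW.adj_iUnion i (p := fun j => j ≠ i) (by simp)
      refine mem_essSupport_retract hd hadj (special_mono ?_ hg) hw ?_
      · rw [← hunion]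
        refine Set.iUnion_subset fun j => ?_
        by_cases hj : j = i
        · exact hj ▸ Set.subset_union_left
        · exact (Set.subset_biUnion_of_mem (s := {j | j ≠ i}) (u := W) hj).trans
            Set.subset_union_right
      · rw [essSupport_conj, ← hunion]
        exact Set.mem_iUnion_of_mem i hw
  choose a ha using hcyc
  refine ⟨m, W, a, g, hW, hne, fun i => ?_, fun x hx => ?_⟩
  · obtain ⟨x, -, hx⟩ := (ha i).ge (Subgroup.mem_zpowers (a i))
    exact hx ▸ retract_mem _ x
  · refine (iSup_mono fun i => ?_ : _ ≤ ⨆ i, Subgroup.zpowers (a i))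
      (hW.mem_iSup_zpowers_retract (hunion ▸ hsub hx))
    rw [Subgroup.zpowers_le, ← ha i]
    exact Subgroup.mem_map_of_mem _ hx

end RAAG

/-! ### Maximal free abelian subgroups for homogeneous graphs -/

namespace RAAG

/-- A homogeneous graph of dimension `n` has no clique with more than `n` vertices. -/
theorem card_clique_le {n : ℕ} : ∀ {V : Type u} {Γ : SimpleGraph V},
    IsHomogeneous n Γ → ∀ {k : ℕ} (f : Fin k → V), (∀ i j, i ≠ j → Γ.Adj (f i) (f j)) → k ≤ n := by
  match n with
  | 0 =>
    rintro V Γ h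
    exact h.elim
  | 1 =>
    rintro V Γ ⟨-, rfl⟩ k f hf
    by_contra hk
    exact hf ⟨0, by omega⟩ ⟨1, by omega⟩ (by simp)
  | n + 2 =>
    rintro V Γ ⟨-, h⟩ k f hf
    rcases k with _ | k
    · omega
    have := card_clique_le (h (f 0))
      (fun i : Fin k => ⟨f i.succ, hf 0 i.succ (Fin.succ_ne_zero i).symm⟩)
      fun i j hij => hf i.succ j.succ (by simpa using hij)
    omega

variable {V : Type u} {Γ : SimpleGraph V}

/-- Choosing one vertex in each factor of a join gives a clique. -/
theorem IsJoin.card_le {m n : ℕ} {W : Fin m → Set V} (hW : IsJoin Γ W)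
    (hne : ∀ i, (W i).Nonempty) (hΓ : IsHomogeneous n Γ) : m ≤ n := by
  choose f hf using hne
  exact card_clique_le hΓ f fun i j hij => hW.adj i j hij _ (hf i) _ (hf j)

/-- In a join with the maximal number of factors, an edge in a factor would give a larger clique. -/
theorem IsJoin.induce_eq_bot {n : ℕ} {W : Fin n → Set V} (hW : IsJoin Γ W)
    (hne : ∀ i, (W i).Nonempty) (hΓ : IsHomogeneous n Γ) (i : Fin n) :
    Γ.induce (W i) = ⊥ := by
  classical
  choose f hf using hne
  -- replace the chosen vertex in `W i` by `w`, and add `v`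
  ext ⟨v, hv⟩ ⟨w, hw⟩
  simp only [SimpleGraph.comap_adj, Function.Embedding.subtype_apply, SimpleGraph.bot_adj,
    iff_false]
  intro hvw
  have hf' : ∀ j, Function.update f i w j ∈ W j := fun j => by
    by_cases h : j = i
    · subst h
      simpa using hw
    · simpa [h] using hf j
  have hv' : ∀ j, Γ.Adj v (Function.update f i w j) := fun j => by
    by_cases h : j = i
    · subst h
      simpa using hvw
    · exact hW.adj i j (Ne.symm h) v hv _ (hf' j)
  have := card_clique_le hΓ (Fin.cons v (Function.update f i w) : Fin (n + 1) → V) <| by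
    intro j k hjk
    cases j using Fin.cases with
    | zero =>
      cases k using Fin.cases with
      | zero => exact absurd rfl hjk
      | succ k => simpa using hv' k
    | succ j =>
      cases k using Fin.cases with
      | zero => simpa using (hv' j).symm
      | succ k => simpa using hW.adj j k (by simpa using hjk) _ (hf' j) _ (hf' k)
  omega

theorem isZnSubgroup_conjSubgroup_iff {G : Type u} [Group G] {n : ℕ} (g : G) {H : Subgroup G} :
    IsZnSubgroup n (conjSubgroup g H) ↔ IsZnSubgroup n H := by
  let e : H ≃* conjSubgroup g H :=
    H.equivMapOfInjective (MulAut.conj g).toMonoidHom (MulAut.conj g).injective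
  exact ⟨fun ⟨f⟩ => ⟨e.trans f⟩, fun ⟨f⟩ => ⟨e.symm.trans f⟩⟩

theorem conjSubgroup_conjSubgroup_inv {G : Type u} [Group G] (g : G) (H : Subgroup G) :
    conjSubgroup g (conjSubgroup g⁻¹ H) = H := by
  ext x
  simp only [mem_conjSubgroup]
  constructor
  · rintro ⟨_, ⟨y, hy, rfl⟩, rfl⟩
    simpa [mul_assoc] using hy
  · exact fun hx => ⟨_, ⟨x, hx, rfl⟩, by group⟩

theorem conjSubgroup_mono {G : Type u} [Group G] (g : G) {H K : Subgroup G} (h : H ≤ K) :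
    conjSubgroup g H ≤ conjSubgroup g K := Subgroup.map_mono h

theorem IsMaximalZnSubgroup.conjSubgroup {G : Type u} [Group G] {n : ℕ} {H : Subgroup G}
    (h : IsMaximalZnSubgroup n H) (g : G) : IsMaximalZnSubgroup n (RAAG.conjSubgroup g H) := by
  refine ⟨(isZnSubgroup_conjSubgroup_iff g).2 h.1, fun K hK hle => ?_⟩
  have h1 := conjSubgroup_mono g⁻¹ hle
  have h2 := conjSubgroup_conjSubgroup_inv g⁻¹ H
  rw [inv_inv] at h2
  rw [h2] at h1
  have h3 := h.2 ((isZnSubgroup_conjSubgroup_iff g⁻¹).2 hK) h1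
  simpa [conjSubgroup_conjSubgroup_inv] using conjSubgroup_mono g h3

/-- A subgroup generated by `m` commuting elements that contains a copy of `ℤⁿ` with `m ≤ n` is
itself isomorphic to `ℤᵐ`, and `m = n`: the kernel of the map from `ℤᵐ` onto it has rank zero. -/
theorem isZnSubgroup_iSup_zpowers {G : Type u} [Group G] {m n : ℕ} {a : Fin m → G}
    (ha : ∀ i j, Commute (a i) (a j)) {H : Subgroup G} (hH : IsZnSubgroup n H)
    (hle : H ≤ ⨆ i, Subgroup.zpowers (a i)) (hmn : m ≤ n) :
    m = n ∧ IsZnSubgroup m (⨆ i, Subgroup.zpowers (a i)) := by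
  obtain ⟨f⟩ := hH
  have hcomm : Pairwise fun i j => ∀ x y : Multiplicative ℤ,
      Commute (zpowersHom G (a i) x) (zpowersHom G (a j) y) := fun i j _ x y => by
    simpa only [zpowersHom_apply] using ((ha i j).zpow_left _).zpow_right _
  let π : Multiplicative (Fin m → ℤ) →* G :=
    (MonoidHom.noncommPiCoprod (fun i => zpowersHom G (a i)) hcomm).comp
      (MulEquiv.funMultiplicative (Fin m) ℤ).toMonoidHom
  have hrange : π.range = ⨆ i, Subgroup.zpowers (a i) := by
    rw [MonoidHom.range_comp, MonoidHom.range_eq_top.2 (MulEquiv.surjective _),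
      ← MonoidHom.range_eq_map, MonoidHom.noncommPiCoprod_range]
    rfl
  let M : Submodule ℤ (Fin m → ℤ) :=
    AddSubgroup.toIntSubmodule (Subgroup.toAddSubgroup' (H.comap π))
  have hM : ∀ x : M, π (Multiplicative.ofAdd (x : Fin m → ℤ)) ∈ H := fun x => x.2
  let L : M →ₗ[ℤ] (Fin n → ℤ) := AddMonoidHom.toIntLinearMap <| AddMonoidHom.mk'
    (fun x => (f ⟨π (Multiplicative.ofAdd (x : Fin m → ℤ)), hM x⟩).toAdd) fun x y => by
      rw [← toAdd_mul, ← map_mul]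
      congr 2
      exact Subtype.ext (map_mul π (Multiplicative.ofAdd _) (Multiplicative.ofAdd _))
  have hL : ∀ x : M, L x = (f ⟨π (Multiplicative.ofAdd (x : Fin m → ℤ)), hM x⟩).toAdd :=
    fun _ => rfl
  have hsurj : Function.Surjective L := by
    intro z
    obtain ⟨y, hy⟩ := f.surjective (Multiplicative.ofAdd z)
    obtain ⟨x, hx⟩ := hrange.ge (hle y.2)
    have hxH : π x ∈ H := hx ▸ y.2
    refine ⟨⟨x.toAdd, hxH⟩, ?_⟩
    rw [hL, ← toAdd_ofAdd z, ← hy]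
    congr 2
    exact Subtype.ext hx
  have h1 := (LinearMap.ker L).finrank_quotient_add_finrank
  rw [(L.quotKerEquivOfSurjective hsurj).finrank_eq, Module.finrank_fin_fun] at h1
  have h2 : Module.finrank ℤ M ≤ m := by
    simpa using Submodule.finrank_le M
  have h3 : Module.finrank ℤ (LinearMap.ker L) = 0 := by omega
  have h4 : LinearMap.ker L = ⊥ := Submodule.finrank_eq_zero.1 h3
  have hinj : Function.Injective π := by
    rw [injective_iff_map_eq_one]
    intro x hx
    have hxH : π x ∈ H := hx ▸ one_mem H
    have h5 : (⟨x.toAdd, hxH⟩ : M) ∈ LinearMap.ker L := by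
      rw [LinearMap.mem_ker, hL, show (⟨π (Multiplicative.ofAdd x.toAdd), hxH⟩ : H) = 1 from
        Subtype.ext hx, map_one, toAdd_one]
    rw [h4, Submodule.mem_bot] at h5
    exact congrArg Subtype.val h5
  exact ⟨by omega, hrange ▸ ⟨(MonoidHom.ofInjective hinj).symm⟩⟩

theorem IsZnSubgroup.mul_comm {G : Type u} [Group G] {n : ℕ} {H : Subgroup G}
    (h : IsZnSubgroup n H) : ∀ x ∈ H, ∀ y ∈ H, x * y = y * x := by
  obtain ⟨f⟩ := h
  intro x hx y hy
  have : (⟨x, hx⟩ * ⟨y, hy⟩ : H) = ⟨y, hy⟩ * ⟨x, hx⟩ :=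
    f.injective (by rw [map_mul, map_mul, _root_.mul_comm])
  exact congrArg Subtype.val this

end RAAG

theorem mainTheorem8 {V : Type u} [Finite V] (Γ : SimpleGraph V) :
    (∀ H : Subgroup (RAAG Γ), (∀ x ∈ H, ∀ y ∈ H, x * y = y * x) →
      ∃ (m : ℕ) (W : Fin m → Set V) (a : Fin m → RAAG Γ) (P : Subgroup (RAAG Γ)) (g : RAAG Γ),
        RAAG.IsJoin Γ W ∧ (∀ i, (W i).Nonempty) ∧
        RAAG.IsInternalProduct (fun i => RAAG.special Γ (W i)) (RAAG.special Γ (⋃ i, W i)) ∧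
        (∀ i, a i ∈ RAAG.special Γ (W i)) ∧
        RAAG.IsInternalProduct (fun i => Subgroup.zpowers (a i)) P ∧
        RAAG.conjSubgroup g H ≤ P) ∧
    (∀ (n : ℕ), RAAG.IsHomogeneous n Γ →
      ∀ H : Subgroup (RAAG Γ), RAAG.IsMaximalZnSubgroup n H →
      ∃ (W : Fin n → Set V) (a : Fin n → RAAG Γ) (g : RAAG Γ),
        RAAG.IsJoin Γ W ∧ (∀ i, (W i).Nonempty) ∧ (∀ i, Γ.induce (W i) = ⊥) ∧
        RAAG.IsInternalProduct (fun i => RAAG.special Γ (W i)) (RAAG.special Γ (⋃ i, W i)) ∧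
        (∀ i, a i ∈ RAAG.special Γ (W i)) ∧
        RAAG.IsInternalProduct (fun i => Subgroup.zpowers (a i)) (RAAG.conjSubgroup g H) ∧
        RAAG.IsBasicZnSubgroup Γ n (RAAG.conjSubgroup g H)) := by
  refine ⟨fun H hH => ?_, fun n hΓ H hH => ?_⟩
  · obtain ⟨m, W, a, g, hW, hne, ha, hle⟩ := RAAG.exists_conjSubgroup_le_iSup_zpowers hH
    exact ⟨m, W, a, _, g, hW, hne, hW.isInternalProduct, ha, hW.isInternalProduct_zpowers ha, hle⟩
  · obtain ⟨m, W, a, g, hW, hne, ha, hle⟩ :=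
      RAAG.exists_conjSubgroup_le_iSup_zpowers hH.1.mul_comm
    have hmax := hH.conjSubgroup g
    have hcomm : ∀ i j, Commute (a i) (a j) := fun i j => by
      by_cases hij : i = j
      · rw [hij]
      · exact hW.isInternalProduct.commute i j hij _ (ha i) _ (ha j)
    obtain ⟨rfl, hZn⟩ :=
      RAAG.isZnSubgroup_iSup_zpowers hcomm hmax.1 hle (hW.card_le hne hΓ)
    have heq : RAAG.conjSubgroup g H = ⨆ i, Subgroup.zpowers (a i) :=
      le_antisymm hle (hmax.2 hZn hle)
    have hdisc := hW.induce_eq_bot hne hΓ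
    refine ⟨W, a, g, hW, hne, hdisc, hW.isInternalProduct, ha,
      heq ▸ hW.isInternalProduct_zpowers ha, hmax, W, hW, hne, hdisc, ?_⟩
    exact hle.trans (iSup_le fun i => (Subgroup.zpowers_le.2 (ha i)).trans
      (RAAG.special_mono (Set.subset_iUnion W i)))
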